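/- Let $\mathcal G=(\mathcal V,\mathcal E)$ be a finite strongly connected digraph with $n\ge 2$ nodes and no self-loops, where $(v_j,v_i)\in\mathcal E$ denotes an edge carrying flow from $v_i$ to $v_j$. Let $l_{ji},u_{ji}\in\mathbb R$ with $0<l_{ji}\le u_{ji}$ be limits on the edges that satisfy the integer circulation conditions: (i) $\lceil l_{ji}\rceil\le\lfloor u_{ji}\rfloor$ for every $(v_j,v_i)\in\mathcal E$; (ii) for every $\mathcal S\subset\mathcal V$, $$\sum_{(v_j,v_i)\in\mathcal E,\ v_j\in\mathcal S,\ v_i\notin\mathcal S}\lceil l_{ji}\rceil\ \le\ \sum_{(v_l,v_j)\in\mathcal E,\ v_j\in\mathcal S,\ v_l\notin\mathcal S}\lfloor u_{lj}\rfloor .$$ Each node $v_j$ numbers its $\mathcal D_j$ incoming and outgoing edges by $0,\dots,\mathcal D_j-1$ in an arbitrary fixed order without repetition. The flow $f_{ji}$ of an edge is kept by its tail $v_i$, while the head $v_j$ keeps a perceived flow $f^{(p)}_{ji}$. Initially $f_{ji}[0]=f^{(p)}_{ji}[0]=\lceil l_{ji}\rceil$. At each iteration $k=0,1,2,\dots$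 the following happens. 1. Each node $v_j$ computes its perceived balance $b^{(p)}_j[k]=\sum_i f^{(p)}_{ji}[k]-\sum_l f_{lj}[k]$. If it is positive, then, working on its own copies of the values $f^{(p)}_{ji}[k]$ and $f_{lj}[k]$, the node goes cyclically through its incoming and outgoing edges (starting with the edge numbered $0$ the first time, and afterwards with the edge following the last one tried), increasing outgoing flows and decreasing incoming flows by $1$, one at a time and skipping an edge that is at its maximum $\lfloor u_{lj}\rfloor$, respectively minimum $\lceil l_{ji}\rceil$, until its perceived balance is zero; the resulting values are its desired flows $f^{(j)}_{ji}[k]$, $f^{(j)}_{lj}[k]$. If the perceived balance is not positive, its desired flows are $f^{(j)}_{ji}[k]=f^{(p)}_{ji}[k]$ and $f^{(j)}_{lj}[k]=f_{lj}[k]$. 2. Over each edge $(v_j,v_i)$ the head $v_j$ transmits $f^{(j)}_{ji}[k]$ to the tail $v_i$. If the packet is dropped, $v_i$ uses $f_{ji}[k]$ in place of $f^{(j)}_{ji}[k]$. The tail sets $f_{ji}[k+1]=f^{(j)}_{ji}[k]+f^{(i)}_{ji}[k]-f_{ji}[k]$, projected onto the interval $[\lceil l_{ji}\rceil,\lfloor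 u_{ji}\rfloor]$. 3. The tail $v_i$ transmits $f_{ji}[k+1]$ to the head $v_j$, which sets $f^{(p)}_{ji}[k+1]=f_{ji}[k+1]$ if the packet arrives and $f^{(p)}_{ji}[k+1]=f^{(j)}_{ji}[k]$ if it is dropped. Assume that packet drops are independent Bernoulli events over different iterations, different edges and the two directions of an edge, and that each direction of each edge has a drop probability, constant over time, that is less than $1$. Then, with probability one, there is a $k_0$ such that for all $k\ge k_0$: $f_{ji}[k]=f_{ji}[k_0]$ is a positive integer with $l_{ji}\le f_{ji}[k]\le u_{ji}$ for every $(v_j,v_i)\in\mathcal E$, and the balance $b_j[k]=\sum_i f_{ji}[k]-\sum_l f_{lj}[k]$ is $0$ for every $v_j\in\mathcal V$. -/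

import Mathlib

open MeasureTheory ProbabilityTheory

noncomputable section

namespace FlowBalancing

/-- The edges of a digraph: `⟨(i, j), _⟩` is the edge that carries flow from `i` to `j`. -/
abbrev Edge {V : Type*} (G : Digraph V) := {e : V × V // G.Adj e.1 e.2}

/-- The node from which the edge carries flow. -/
def Edge.tail {V : Type*} {G : Digraph V} (e : Edge G) : V := e.1.1

/-- The node to which the edge carries flow. -/
def Edge.head {V : Type*} {G : Digraph V} (e : Edge G) : V := e.1.2

/-- There is a directed path from every node to every node. -/
def StronglyConnected {V : Type*} (G : Digraph V) : Prop :=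
  ∀ i j : V, Relation.ReflTransGen G.Adj i j

section

variable {V : Type*} [Fintype V] [DecidableEq V] {G : Digraph V} [DecidableRel G.Adj]

/-- The incoming edges of a node. -/
def inEdges (G : Digraph V) [DecidableRel G.Adj] (v : V) : Finset (Edge G) :=
  Finset.univ.filter fun e => e.head = v

/-- The outgoing edges of a node. -/
def outEdges (G : Digraph V) [DecidableRel G.Adj] (v : V) : Finset (Edge G) :=
  Finset.univ.filter fun e => e.tail = v

/-- In-degree plus out-degree. -/
def totalDegree (G : Digraph V) [DecidableRel G.Adj] (v : V) : ℕ :=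
  (inEdges G v).card + (outEdges G v).card

/-- The edges that enter the node set `S` from its complement. -/
def edgesInto (G : Digraph V) [DecidableRel G.Adj] (S : Finset V) : Finset (Edge G) :=
  Finset.univ.filter fun e => e.head ∈ S ∧ e.tail ∉ S

/-- The edges that leave the node set `S` towards its complement. -/
def edgesOutOf (G : Digraph V) [DecidableRel G.Adj] (S : Finset V) : Finset (Edge G) :=
  Finset.univ.filter fun e => e.tail ∈ S ∧ e.head ∉ S

/-- The flow balance of a node: in-flow minus out-flow. -/
def balance (f : Edge G → ℤ) (v : V) : ℤ :=
  ∑ e ∈ inEdges G v, f e - ∑ e ∈ outEdges G v, f e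

/-- The integer circulation conditions for the lower and upper limits `l` and `u`. -/
structure IntegerCirculationConditions (l u : Edge G → ℝ) : Prop where
  interval : ∀ e, ⌈l e⌉ ≤ ⌊u e⌋
  cut : ∀ S : Finset V, ∑ e ∈ edgesInto G S, ⌈l e⌉ ≤ ∑ e ∈ edgesOutOf G S, ⌊u e⌋

/-- Each node `v` orders its incoming and outgoing edges: `P v` numbers them, without
repetition, by `0, 1, …, totalDegree G v - 1`. -/
def IsEdgeOrder (P : V → Edge G → ℕ) : Prop :=
  ∀ v, Set.BijOn (P v) (inEdges G v ∪ outEdges G v : Finset (Edge G))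
    (Set.Iio (totalDegree G v))

/-- The working memory of one node while it selects its desirable flows: a value for each of
its incoming and outgoing edges (the values on other edges are never used), and the number, in
the node's own order, of the edge that is to be tried next. -/
structure NodeMemory (G : Digraph V) where
  flow : Edge G → ℤ
  next : ℕ

/-- Node `v` tries the edge whose turn it is: an outgoing edge is increased by one unless it is
at its maximum, an incoming edge is decreased by one unless it is at its minimum. In any case
the turn passes cyclically to the following edge. -/
def tryNextEdge (l u : Edge G → ℝ) (P : V → Edge G → ℕ) (v : V) (s : NodeMemory G) :
    NodeMemory G where
  flow e :=
    if e.tail = v ∧ P v e = s.next ∧ s.flow e < ⌊u e⌋ then s.flow e + 1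
    else if e.head = v ∧ P v e = s.next ∧ ⌈l e⌉ < s.flow e then s.flow e - 1
    else s.flow e
  next := (s.next + 1) % totalDegree G v

open Classical in
/-- Node `v` tries its edges one at a time until its balance, as computed from its own memory,
is no longer positive. Every trial changes this balance by at most one, so that a positive
balance is driven to exactly zero; if the balance is not positive at the start, then nothing is
changed. -/
def selectDesirable (l u : Edge G → ℝ) (P : V → Edge G → ℕ) (v : V) (s : NodeMemory G) :
    NodeMemory G :=
  if h : ∃ n : ℕ, balance ((tryNextEdge l u P v)^[n] s).flow v ≤ 0 then
    (tryNextEdge l u P v)^[Nat.find h] s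
  else s

/-- The state of the network at the start of an iteration: the actual flows (each is kept by the
tail of the edge), the perceived flows (each is kept by the head of the edge), and for every
node the number of the edge at which it continues its cyclic order. -/
structure NetworkState (G : Digraph V) where
  flow : Edge G → ℤ
  perceived : Edge G → ℤ
  next : V → ℕ

/-- All flows and perceived flows start at the smallest integer not below the lower limit. -/
def startState (l : Edge G → ℝ) : NetworkState G where
  flow e := ⌈l e⌉
  perceived e := ⌈l e⌉
  next _ := 0

/-- What node `v` knows: the perceived flows on its incoming edges and the actual flows on its
outgoing edges. The balance computed from this is the perceived flow balance of `v`. -/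
def nodeView (s : NetworkState G) (v : V) : NodeMemory G where
  flow e := if e.head = v then s.perceived e else s.flow e
  next := s.next v

/-- The two directions of transmission over an edge: from the tail to the head, and from the
head back to the tail. -/
inductive Direction
  | toHead
  | toTail
  deriving DecidableEq

/-- One iteration of the algorithm. `ok e d` tells whether the transmission over the edge `e` in
direction `d` gets through. -/
def iteration (l u : Edge G → ℝ) (P : V → Edge G → ℕ) (ok : Edge G → Direction → Bool)
    (s : NetworkState G) : NetworkState G :=
  let desired : V → NodeMemory G := fun v => selectDesirable l u P v (nodeView s v)
  -- the flow on `e` desired by its tail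
  let byTail : Edge G → ℤ := fun e => (desired e.tail).flow e
  -- the flow on `e` desired by its head, which the head transmits to the tail
  let byHead : Edge G → ℤ := fun e => (desired e.head).flow e
  -- what the tail takes for the flow desired by the head
  let received : Edge G → ℤ := fun e => if ok e .toTail then byHead e else s.flow e
  -- the new flow, projected onto the feasible interval, which the tail transmits to the head
  let newFlow : Edge G → ℤ := fun e =>
    max ⌈l e⌉ (min ⌊u e⌋ (received e + byTail e - s.flow e))
  { flow := newFlow
    perceived := fun e => if ok e .toHead then newFlow e else byHead e
    next := fun v => (desired v).next }

/-- The state at the start of iteration `k`, where `ok k e d` tells whether the transmission over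
the edge `e` in direction `d` at iteration `k` gets through. -/
def run (l u : Edge G → ℝ) (P : V → Edge G → ℕ) (ok : ℕ → Edge G → Direction → Bool) :
    ℕ → NetworkState G
  | 0 => startState l
  | k + 1 => iteration l u P (ok k) (run l u P ok k)

/-- Packets are dropped independently at different iterations, on different edges and in
different directions, and with probability `q e d` on the edge `e` in direction `d`
(`x (k, e, d) = false` if the packet of iteration `k` is dropped). -/
structure IsPacketDropModel {Ω : Type*} [MeasurableSpace Ω] (μ : Measure Ω)
    (q : Edge G → Direction → ℝ) (x : ℕ × Edge G × Direction → Ω → Bool) : Prop where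
  measurable : ∀ i, Measurable (x i)
  indep : iIndepFun x μ
  drop : ∀ k e d, μ.real {ω | x (k, e, d) ω = false} = q e d

end

end FlowBalancing

end

open FlowBalancing

/-! In choosing desired flows, the head of an edge only lowers its value and the tail only raises
it. Hence `⌈l e⌉ ≤ perceived ≤ flow ≤ ⌊u e⌋` survives every pattern of drops
(`IsFeasible.iteration`). A feasible state with correct perceived flows and zero balances is fixed
by every iteration (`iteration_of_balanced`), so it is enough to reach such a state once.

Without drops this always happens (`exists_lossless_balanced`). Let `S` be the set of nodes whose
balance is positive infinitely often. A node outside `S` eventually has nonpositive balance, which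
can then only grow, so it becomes constant and the node receives nothing more; the edges between `S`
and its complement freeze. Nodes of `S` keep trying these edges cyclically, so those leaving `S` are
at their maximum and those entering `S` at their minimum (`eventually_saturated`). The cut condition
now makes the total balance of `S` nonpositive, while each balance in `S` is eventually nonnegative.
All of them vanish, so `S` is empty. Then all balances are eventually nonpositive, and since they
sum to zero they are zero.

Only finitely many synchronized feasible states exist, so one number `N` of lossless iterations
balances all of them. By the second Borel–Cantelli lemma, `N + 1` successive lossless iterations
occur almost surely: the first corrects the perceived flows, the others balance the network. -/

namespace FlowBalancing

/-! ### Edge trials at a single node -/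

section SingleNode

variable {V : Type*} [Fintype V] [DecidableEq V] {G : Digraph V} [DecidableRel G.Adj]

omit [Fintype V] [DecidableEq V] [DecidableRel G.Adj] in
theorem tail_ne_head (hloop : ∀ v, ¬ G.Adj v v) (e : Edge G) : e.tail ≠ e.head := by
  intro h
  have h1 := e.2
  unfold Edge.tail Edge.head at h
  rw [h] at h1
  exact hloop _ h1

theorem mem_inEdges {v : V} {e : Edge G} : e ∈ inEdges G v ↔ e.head = v := by
  simp [inEdges]

theorem mem_outEdges {v : V} {e : Edge G} : e ∈ outEdges G v ↔ e.tail = v := by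
  simp [outEdges]

variable {l u : Edge G → ℝ} {P : V → Edge G → ℕ} {v : V}

theorem le_tryNextEdge_of_tail (hloop : ∀ v, ¬ G.Adj v v) {e : Edge G} (he : e.tail = v)
    (s : NodeMemory G) : s.flow e ≤ (tryNextEdge l u P v s).flow e := by
  have := tail_ne_head hloop e
  simp only [tryNextEdge]
  grind

theorem tryNextEdge_le_of_head (hloop : ∀ v, ¬ G.Adj v v) {e : Edge G} (he : e.head = v)
    (s : NodeMemory G) : (tryNextEdge l u P v s).flow e ≤ s.flow e := by
  have := tail_ne_head hloop e
  simp only [tryNextEdge]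
  grind

theorem tryNextEdge_le_floor {e : Edge G} {s : NodeMemory G} (h : s.flow e ≤ ⌊u e⌋) :
    (tryNextEdge l u P v s).flow e ≤ ⌊u e⌋ := by
  simp only [tryNextEdge]
  grind

theorem ceil_le_tryNextEdge {e : Edge G} {s : NodeMemory G} (h : ⌈l e⌉ ≤ s.flow e) :
    ⌈l e⌉ ≤ (tryNextEdge l u P v s).flow e := by
  simp only [tryNextEdge]
  grind

theorem le_iterate_of_tail (hloop : ∀ v, ¬ G.Adj v v) {e : Edge G} (he : e.tail = v)
    (s : NodeMemory G) : Monotone fun n => ((tryNextEdge l u P v)^[n] s).flow e := by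
  refine monotone_nat_of_le_succ fun n => ?_
  simp only [Function.iterate_succ_apply']
  exact le_tryNextEdge_of_tail hloop he _

theorem iterate_le_of_head (hloop : ∀ v, ¬ G.Adj v v) {e : Edge G} (he : e.head = v)
    (s : NodeMemory G) : Antitone fun n => ((tryNextEdge l u P v)^[n] s).flow e := by
  refine antitone_nat_of_succ_le fun n => ?_
  simp only [Function.iterate_succ_apply']
  exact tryNextEdge_le_of_head hloop he _

theorem iterate_le_floor {e : Edge G} {s : NodeMemory G} (h : s.flow e ≤ ⌊u e⌋) (n : ℕ) :
    ((tryNextEdge l u P v)^[n] s).flow e ≤ ⌊u e⌋ := by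
  induction n with
  | zero => exact h
  | succ n ih =>
    rw [Function.iterate_succ_apply']
    exact tryNextEdge_le_floor ih

theorem ceil_le_iterate {e : Edge G} {s : NodeMemory G} (h : ⌈l e⌉ ≤ s.flow e) (n : ℕ) :
    ⌈l e⌉ ≤ ((tryNextEdge l u P v)^[n] s).flow e := by
  induction n with
  | zero => exact h
  | succ n ih =>
    rw [Function.iterate_succ_apply']
    exact ceil_le_tryNextEdge ih

theorem iterate_next {s : NodeMemory G} (hs : s.next < totalDegree G v) (n : ℕ) :
    ((tryNextEdge l u P v)^[n] s).next = (s.next + n) % totalDegree G v := by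
  induction n with
  | zero => simp [Nat.mod_eq_of_lt hs]
  | succ n ih =>
    rw [Function.iterate_succ_apply']
    simp [tryNextEdge, ih, ← add_assoc]

/-- An outgoing edge that was tried without any change was at its maximum. -/
theorem floor_le_of_tried (hloop : ∀ v, ¬ G.Adj v v) {e : Edge G} (he : e.tail = v)
    {s : NodeMemory G} {m n : ℕ} (hmn : m < n)
    (hm : P v e = ((tryNextEdge l u P v)^[m] s).next)
    (hn : ((tryNextEdge l u P v)^[n] s).flow e = s.flow e) : ⌊u e⌋ ≤ s.flow e := by
  have h1 := le_iterate_of_tail (l := l) (u := u) (P := P) hloop he s (Nat.zero_le m)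
  have h2 := le_iterate_of_tail (l := l) (u := u) (P := P) hloop he s (Nat.succ_le_of_lt hmn)
  simp only [Function.iterate_zero, id, Function.iterate_succ_apply', hn] at h1 h2
  by_contra! hc
  have h3 := le_tryNextEdge_of_tail (l := l) (u := u) (P := P) hloop he
    ((tryNextEdge l u P v)^[m] s)
  generalize (tryNextEdge l u P v)^[m] s = t at *
  have h4 : (tryNextEdge l u P v t).flow e = t.flow e + 1 := by
    simp only [tryNextEdge]
    rw [if_pos ⟨he, hm, by omega⟩]
  omega

/-- An incoming edge that was tried without any change was at its minimum. -/
theorem le_ceil_of_tried (hloop : ∀ v, ¬ G.Adj v v) {e : Edge G} (he : e.head = v)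
    {s : NodeMemory G} {m n : ℕ} (hmn : m < n)
    (hm : P v e = ((tryNextEdge l u P v)^[m] s).next)
    (hn : ((tryNextEdge l u P v)^[n] s).flow e = s.flow e) : s.flow e ≤ ⌈l e⌉ := by
  have h1 := iterate_le_of_head (l := l) (u := u) (P := P) hloop he s (Nat.zero_le m)
  have h2 := iterate_le_of_head (l := l) (u := u) (P := P) hloop he s (Nat.succ_le_of_lt hmn)
  simp only [Function.iterate_zero, id, Function.iterate_succ_apply', hn] at h1 h2
  by_contra! hc
  have h3 := tryNextEdge_le_of_head (l := l) (u := u) (P := P) hloop he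
    ((tryNextEdge l u P v)^[m] s)
  generalize (tryNextEdge l u P v)^[m] s = t at *
  have h0 := tail_ne_head hloop e
  have h4 : (tryNextEdge l u P v t).flow e = t.flow e - 1 := by
    simp only [tryNextEdge]
    rw [if_neg (by grind), if_pos ⟨he, hm, by omega⟩]
  omega

theorem balance_tryNextEdge_le (hloop : ∀ v, ¬ G.Adj v v) (s : NodeMemory G) :
    balance (tryNextEdge l u P v s).flow v ≤ balance s.flow v := by
  refine sub_le_sub (Finset.sum_le_sum fun e he => ?_) (Finset.sum_le_sum fun e he => ?_)
  · exact tryNextEdge_le_of_head hloop (mem_inEdges.1 he) s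
  · exact le_tryNextEdge_of_tail hloop (mem_outEdges.1 he) s

/-- The numbering is injective on the edges at `v`, so at most one of them has its turn. This is
what keeps a positive balance from jumping past zero. -/
theorem balance_le_tryNextEdge (hloop : ∀ v, ¬ G.Adj v v) (hP : IsEdgeOrder P)
    (s : NodeMemory G) :
    balance s.flow v ≤ balance (tryNextEdge l u P v s).flow v + 1 := by
  have h1 : ∑ e ∈ inEdges G v, (s.flow e - (tryNextEdge l u P v s).flow e) +
      ∑ e ∈ outEdges G v, ((tryNextEdge l u P v s).flow e - s.flow e) ≤
      ∑ e ∈ inEdges G v ∪ outEdges G v, if P v e = s.next then 1 else 0 := by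
    rw [Finset.sum_union]
    · refine add_le_add (Finset.sum_le_sum fun e he => ?_) (Finset.sum_le_sum fun e he => ?_)
      · have h0 := tail_ne_head hloop e
        rw [mem_inEdges] at he
        simp only [tryNextEdge]
        grind
      · have h0 := tail_ne_head hloop e
        rw [mem_outEdges] at he
        simp only [tryNextEdge]
        grind
    · rw [Finset.disjoint_left]
      intro e h2 h3
      exact tail_ne_head hloop e ((mem_outEdges.1 h3).trans (mem_inEdges.1 h2).symm)
  have h2 : ∑ e ∈ inEdges G v ∪ outEdges G v, (if P v e = s.next then (1 : ℤ) else 0) ≤ 1 := by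
    rw [Finset.sum_boole]
    norm_cast
    rw [Finset.card_le_one]
    intro a ha b hb
    rw [Finset.mem_filter] at ha hb
    exact (hP v).injOn ha.1 hb.1 (ha.2.trans hb.2.symm)
  simp only [Finset.sum_sub_distrib] at h1
  unfold balance
  linarith

end SingleNode

/-- Induction on a bound for the gap `B - a K`, which shrinks at every strict increase. -/
theorem eventually_const_of_monotone {a : ℕ → ℤ} {B : ℤ} {K : ℕ}
    (hmono : ∀ k ≥ K, a k ≤ a (k + 1)) (hB : ∀ k ≥ K, a k ≤ B) :
    ∃ K' ≥ K, ∀ k ≥ K', a (k + 1) = a k := by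
  obtain ⟨d, hd⟩ : ∃ d : ℕ, B - a K ≤ d := ⟨(B - a K).toNat, Int.self_le_toNat _⟩
  induction d generalizing K with
  | zero =>
    refine ⟨K, le_rfl, fun k hk => ?_⟩
    have h1 : ∀ k ≥ K, B ≤ a k := fun k hk => by
      induction k, hk using Nat.le_induction with
      | base => simpa using hd
      | succ k hk ih => exact ih.trans (hmono k hk)
    have h2 := h1 k hk
    have h3 := h1 (k + 1) (by omega)
    have h4 := hB k hk
    have h5 := hB (k + 1) (by omega)
    omega
  | succ d ih =>
    by_cases h : ∀ k ≥ K, a (k + 1) = a k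
    · exact ⟨K, le_rfl, h⟩
    · push Not at h
      obtain ⟨k, hk, hne⟩ := h
      have h1 : ∀ k ≥ K, a K ≤ a k := fun k hk => by
        induction k, hk using Nat.le_induction with
        | base => exact le_rfl
        | succ k hk ih => exact ih.trans (hmono k hk)
      have h2 := h1 k hk
      have h3 := hmono k hk
      obtain ⟨K', hK', h4⟩ := ih (K := k + 1) (fun j hj => hmono j (by omega))
        (fun j hj => hB j (by omega)) (by push_cast at hd; omega)
      exact ⟨K', by omega, h4⟩

/-! ### Termination and result of the selection of desired flows -/

section Selection

variable {V : Type*} [Fintype V] [DecidableEq V] {G : Digraph V} [DecidableRel G.Adj]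
variable {l u : Edge G → ℝ} {P : V → Edge G → ℕ} {v : V}

theorem exists_tried {s : NodeMemory G} (hP : IsEdgeOrder P) (hs : s.next < totalDegree G v)
    {e : Edge G} (he : e.head = v ∨ e.tail = v) (N : ℕ) :
    ∃ n ≥ N, P v e = ((tryNextEdge l u P v)^[n] s).next := by
  have hlt : P v e < totalDegree G v := (hP v).mapsTo (by
    simpa [mem_inEdges, mem_outEdges] using he)
  -- The pointer starts at `s.next`, which is less than the degree; the extra full turn prevents
  -- truncation in the subtraction and makes the index at least `N`.
  refine ⟨(N + 1) * totalDegree G v + P v e - s.next, ?_, ?_⟩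
  · have : N * 1 ≤ N * totalDegree G v := Nat.mul_le_mul_left _ (by omega)
    rw [add_mul]
    omega
  · have h0 : (N + 1) * totalDegree G v = N * totalDegree G v + totalDegree G v := by ring
    rw [iterate_next hs, Nat.add_sub_of_le (by omega), add_comm, Nat.add_mul_mod_self_right,
      Nat.mod_eq_of_lt hlt]

/-- A balance that stayed positive would become constant. Every trial moves it in the same
direction, so no edge would change any more, and a full cycle of trials would find all outgoing
edges at their maximum and all incoming ones at their minimum. The cut condition for `{v}` excludes
a positive balance then. -/
theorem exists_iterate_balance_nonpos (hloop : ∀ v, ¬ G.Adj v v)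
    (hcirc : IntegerCirculationConditions l u) (hP : IsEdgeOrder P) {s : NodeMemory G}
    (hs : s.next < totalDegree G v) :
    ∃ n : ℕ, balance ((tryNextEdge l u P v)^[n] s).flow v ≤ 0 := by
  by_contra! hpos
  obtain ⟨K, -, hK⟩ := eventually_const_of_monotone (K := 0) (B := 0)
    (a := fun n => - balance ((tryNextEdge l u P v)^[n] s).flow v)
    (fun n _ => by
      simp only [Function.iterate_succ_apply']
      exact neg_le_neg (balance_tryNextEdge_le hloop _))
    (fun n _ => by have := hpos n; omega)
  set t := (tryNextEdge l u P v)^[K] s with ht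
  have hadd : ∀ n, (tryNextEdge l u P v)^[n] t = (tryNextEdge l u P v)^[n + K] s := fun n => by
    rw [ht, Function.iterate_add_apply]
  have hbal : ∀ n, balance ((tryNextEdge l u P v)^[n] t).flow v = balance t.flow v := fun n => by
    induction n with
    | zero => rfl
    | succ n ih =>
      rw [← ih, hadd, hadd]
      have := hK (n + K) (by omega)
      simp only [neg_inj] at this
      rw [← this]
      congr 3
      omega
  have htn : t.next < totalDegree G v := by
    rw [ht, iterate_next hs]
    exact Nat.mod_lt _ (by omega)
  have hin : ∀ n, ∀ e ∈ inEdges G v, ((tryNextEdge l u P v)^[n] t).flow e ≤ t.flow e :=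
    fun n e he => iterate_le_of_head hloop (mem_inEdges.1 he) t (Nat.zero_le n)
  have hout : ∀ n, ∀ e ∈ outEdges G v, t.flow e ≤ ((tryNextEdge l u P v)^[n] t).flow e :=
    fun n e he => le_iterate_of_tail hloop (mem_outEdges.1 he) t (Nat.zero_le n)
  -- Incoming flows can only fall and outgoing flows only rise, so an unchanged balance forces
  -- equality edge by edge.
  have hin' : ∀ n, ∀ e ∈ inEdges G v, ((tryNextEdge l u P v)^[n] t).flow e = t.flow e := by
    intro n
    rw [← Finset.sum_eq_sum_iff_of_le (hin n)]
    have h1 := Finset.sum_le_sum (hin n)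
    have h2 := Finset.sum_le_sum (hout n)
    have h3 := hbal n
    unfold balance at h3
    linarith
  have hout' : ∀ n, ∀ e ∈ outEdges G v, t.flow e = ((tryNextEdge l u P v)^[n] t).flow e := by
    intro n
    rw [← Finset.sum_eq_sum_iff_of_le (hout n)]
    have h1 := Finset.sum_le_sum (hin n)
    have h2 := Finset.sum_le_sum (hout n)
    have h3 := hbal n
    unfold balance at h3
    linarith
  have hlo : ∀ e ∈ inEdges G v, t.flow e ≤ ⌈l e⌉ := fun e he => by
    have he' := mem_inEdges.1 he
    obtain ⟨n, -, hn⟩ := exists_tried (l := l) (u := u) hP htn (Or.inl he') 0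
    exact le_ceil_of_tried hloop he' (Nat.lt_succ_self n) hn (hin' _ e he)
  have hhi : ∀ e ∈ outEdges G v, ⌊u e⌋ ≤ t.flow e := fun e he => by
    have he' := mem_outEdges.1 he
    obtain ⟨n, -, hn⟩ := exists_tried (l := l) (u := u) hP htn (Or.inr he') 0
    exact floor_le_of_tried hloop he' (Nat.lt_succ_self n) hn (hout' _ e he).symm
  have hcut := hcirc.cut {v}
  have e1 : edgesInto G {v} = inEdges G v := by
    ext e
    have := tail_ne_head hloop e
    simp [edgesInto, inEdges]
    grind
  have e2 : edgesOutOf G {v} = outEdges G v := by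
    ext e
    have := tail_ne_head hloop e
    simp [edgesOutOf, outEdges]
    grind
  rw [e1, e2] at hcut
  have h1 := Finset.sum_le_sum hlo
  have h2 := Finset.sum_le_sum hhi
  have h3 := hpos K
  rw [← ht] at h3
  unfold balance at h3
  linarith

theorem selectDesirable_eq_iterate (l u : Edge G → ℝ) (P : V → Edge G → ℕ) (v : V)
    (s : NodeMemory G) :
    ∃ n, selectDesirable l u P v s = (tryNextEdge l u P v)^[n] s := by
  unfold selectDesirable
  split_ifs with h
  · exact ⟨_, rfl⟩
  · exact ⟨0, rfl⟩

theorem selectDesirable_of_nonpos {s : NodeMemory G} (hb : balance s.flow v ≤ 0) :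
    selectDesirable l u P v s = s := by
  classical
  unfold selectDesirable
  split_ifs with h
  · have h0 : Nat.find h = 0 := by
      rw [Nat.find_eq_zero]
      exact hb
    rw [h0]
    rfl
  · rfl

theorem balance_selectDesirable_of_pos (hloop : ∀ v, ¬ G.Adj v v)
    (hcirc : IntegerCirculationConditions l u) (hP : IsEdgeOrder P) {s : NodeMemory G}
    (hs : s.next < totalDegree G v) (hb : 0 < balance s.flow v) :
    balance (selectDesirable l u P v s).flow v = 0 := by
  classical
  have h := exists_iterate_balance_nonpos hloop hcirc hP hs
  unfold selectDesirable
  rw [dif_pos h]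
  have h1 := Nat.find_spec h
  refine le_antisymm h1 ?_
  cases hn : Nat.find h with
  | zero =>
    rw [hn] at h1
    exact hb.le
  | succ m =>
    have h2 := Nat.find_min h (m := m) (by omega)
    rw [Function.iterate_succ_apply']
    have := balance_le_tryNextEdge (l := l) (u := u) (v := v) hloop hP ((tryNextEdge l u P v)^[m] s)
    omega

end Selection

end FlowBalancing

namespace FlowBalancing

/-! ### Invariants of the network and lossless dynamics -/

section Network

open Filter

variable {V : Type*} [Fintype V] [DecidableEq V] {G : Digraph V} [DecidableRel G.Adj]

theorem totalDegree_pos (hn : 2 ≤ Fintype.card V) (hconn : StronglyConnected G) (v : V) :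
    0 < totalDegree G v := by
  have : Nontrivial V := Fintype.one_lt_card_iff_nontrivial.1 hn
  obtain ⟨w, hw⟩ := exists_ne v
  rcases (hconn v w).cases_head with h | ⟨c, hc, -⟩
  · exact absurd h.symm hw
  · refine Nat.add_pos_right _ (Finset.card_pos.2 ⟨⟨(v, c), hc⟩, ?_⟩)
    exact mem_outEdges.2 rfl

/-- The bounds that every reachable state satisfies. -/
structure IsFeasible (l u : Edge G → ℝ) (s : NetworkState G) : Prop where
  ceil_le : ∀ e, ⌈l e⌉ ≤ s.perceived e
  perceived_le : ∀ e, s.perceived e ≤ s.flow e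
  le_floor : ∀ e, s.flow e ≤ ⌊u e⌋
  next_lt : ∀ v, s.next v < totalDegree G v

variable {l u : Edge G → ℝ} {P : V → Edge G → ℕ} {s : NetworkState G}

theorem desired_le_perceived (hloop : ∀ v, ¬ G.Adj v v) (s : NetworkState G) (e : Edge G) :
    (selectDesirable l u P e.head (nodeView s e.head)).flow e ≤ s.perceived e := by
  obtain ⟨n, hn⟩ := selectDesirable_eq_iterate l u P e.head (nodeView s e.head)
  rw [hn]
  refine (iterate_le_of_head hloop rfl _ (Nat.zero_le n)).trans ?_
  simp [nodeView]

theorem flow_le_desired (hloop : ∀ v, ¬ G.Adj v v) (s : NetworkState G) (e : Edge G) :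
    s.flow e ≤ (selectDesirable l u P e.tail (nodeView s e.tail)).flow e := by
  obtain ⟨n, hn⟩ := selectDesirable_eq_iterate l u P e.tail (nodeView s e.tail)
  rw [hn]
  refine le_trans ?_ (le_iterate_of_tail hloop rfl _ (Nat.zero_le n))
  simp [nodeView, (tail_ne_head hloop e).symm]

theorem IsFeasible.ceil_le_desired (hs : IsFeasible l u s) (e : Edge G) :
    ⌈l e⌉ ≤ (selectDesirable l u P e.head (nodeView s e.head)).flow e := by
  obtain ⟨n, hn⟩ := selectDesirable_eq_iterate l u P e.head (nodeView s e.head)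
  rw [hn]
  apply ceil_le_iterate
  simpa [nodeView] using hs.ceil_le e

theorem IsFeasible.desired_le_floor (hloop : ∀ v, ¬ G.Adj v v) (hs : IsFeasible l u s)
    (e : Edge G) :
    (selectDesirable l u P e.tail (nodeView s e.tail)).flow e ≤ ⌊u e⌋ := by
  obtain ⟨n, hn⟩ := selectDesirable_eq_iterate l u P e.tail (nodeView s e.tail)
  rw [hn]
  apply iterate_le_floor
  simpa [nodeView, (tail_ne_head hloop e).symm] using hs.le_floor e

/-- The delicate bound is `perceived ≤ flow` when the packet to the head is lost. The head then
keeps its desired value, which is at most the old flow; since the tail wants no less than the old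
flow, the new flow is at least the head's value whether or not the tail received it. -/
theorem IsFeasible.iteration (hloop : ∀ v, ¬ G.Adj v v) (hs : IsFeasible l u s)
    (ok : Edge G → Direction → Bool) : IsFeasible l u (iteration l u P ok s) where
  ceil_le e := by
    have h1 := hs.ceil_le_desired (P := P) e
    by_cases ho : ok e .toHead
    · simp [FlowBalancing.iteration, ho]
    · simpa [FlowBalancing.iteration, ho] using h1
  perceived_le e := by
    have h1 := desired_le_perceived (l := l) (u := u) (P := P) hloop s e
    have h2 := flow_le_desired (l := l) (u := u) (P := P) hloop s e
    have h3 := hs.perceived_le e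
    have h4 := hs.le_floor e
    simp only [FlowBalancing.iteration]
    split_ifs
    · exact le_rfl
    · exact le_rfl
    · refine le_max_of_le_right (le_min ?_ ?_) <;> omega
    · refine le_max_of_le_right (le_min ?_ ?_) <;> omega
  le_floor e := by
    have h1 := hs.ceil_le e
    have h2 := hs.perceived_le e
    have h3 := hs.le_floor e
    exact max_le (by omega) (min_le_left _ _)
  next_lt v := by
    obtain ⟨n, hn⟩ := selectDesirable_eq_iterate l u P v (nodeView s v)
    simp only [FlowBalancing.iteration]
    rw [hn, iterate_next (hs.next_lt v)]
    exact Nat.mod_lt _ (Nat.zero_lt_of_lt (hs.next_lt v))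

theorem isFeasible_startState (hn : 2 ≤ Fintype.card V) (hconn : StronglyConnected G)
    (hcirc : IntegerCirculationConditions l u) : IsFeasible l u (startState l) where
  ceil_le _ := le_rfl
  perceived_le _ := le_rfl
  le_floor e := hcirc.interval e
  next_lt v := totalDegree_pos hn hconn v

omit [Fintype V] [DecidableRel G.Adj] in
theorem nodeView_flow (h : s.perceived = s.flow) (v : V) : (nodeView s v).flow = s.flow := by
  ext e
  simp [nodeView, h]

/-- A balanced state in which all perceived flows are correct never changes again, whatever
packets are dropped. -/
theorem iteration_of_balanced (hs : IsFeasible l u s) (h : s.perceived = s.flow)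
    (hb : ∀ v, balance s.flow v = 0) (ok : Edge G → Direction → Bool) :
    iteration l u P ok s = s := by
  have hd : ∀ v, selectDesirable l u P v (nodeView s v) = nodeView s v := fun v => by
    apply selectDesirable_of_nonpos
    rw [nodeView_flow h, hb]
  have hf : ∀ e, max ⌈l e⌉ (min ⌊u e⌋ (s.flow e)) = s.flow e := fun e => by
    have h1 := hs.ceil_le e
    have h2 := hs.le_floor e
    rw [h] at h1
    rw [min_eq_right h2, max_eq_right h1]
  obtain ⟨f, p, nx⟩ := s
  simp only [NetworkState.mk.injEq, FlowBalancing.iteration, hd, nodeView_flow h] at *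
  refine ⟨?_, ?_, ?_⟩
  · ext e
    simp [hf]
  · ext e
    simp [hf, h]
  · ext v
    rfl

/-- An iteration in which no packet is dropped. -/
noncomputable abbrev losslessIteration (l u : Edge G → ℝ) (P : V → Edge G → ℕ) :
    NetworkState G → NetworkState G :=
  iteration l u P fun _ _ => true

theorem losslessIteration_perceived (s : NetworkState G) :
    (losslessIteration l u P s).perceived = (losslessIteration l u P s).flow := by
  ext e
  simp [losslessIteration, iteration]

/-- The projection is inactive: the sum lies between the value desired by the head and the one
desired by the tail, and both respect the limits. -/
theorem losslessIteration_flow (hloop : ∀ v, ¬ G.Adj v v) (hs : IsFeasible l u s)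
    (h : s.perceived = s.flow) (e : Edge G) :
    (losslessIteration l u P s).flow e =
      (selectDesirable l u P e.head (nodeView s e.head)).flow e +
      (selectDesirable l u P e.tail (nodeView s e.tail)).flow e - s.flow e := by
  have h1 := desired_le_perceived (l := l) (u := u) (P := P) hloop s e
  have h2 := flow_le_desired (l := l) (u := u) (P := P) hloop s e
  have h3 := hs.ceil_le_desired (P := P) e
  have h4 := hs.desired_le_floor (P := P) hloop e
  rw [h] at h1
  simp only [losslessIteration, iteration, if_true]
  rw [min_eq_right, max_eq_right] <;> omega

/-- What a node receives in an iteration without losses. -/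
noncomputable def received (l u : Edge G → ℝ) (P : V → Edge G → ℕ) (s : NetworkState G) (v : V) : ℤ :=
  ∑ e ∈ inEdges G v, ((selectDesirable l u P e.tail (nodeView s e.tail)).flow e - s.flow e) +
  ∑ e ∈ outEdges G v, (s.flow e - (selectDesirable l u P e.head (nodeView s e.head)).flow e)

theorem received_in_nonneg (hloop : ∀ v, ¬ G.Adj v v) (s : NetworkState G) (e : Edge G) :
    0 ≤ (selectDesirable l u P e.tail (nodeView s e.tail)).flow e - s.flow e :=
  sub_nonneg.2 (flow_le_desired hloop s e)

theorem received_out_nonneg (hloop : ∀ v, ¬ G.Adj v v) (h : s.perceived = s.flow)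
    (e : Edge G) :
    0 ≤ s.flow e - (selectDesirable l u P e.head (nodeView s e.head)).flow e :=
  sub_nonneg.2 (h ▸ desired_le_perceived hloop s e)

theorem received_nonneg (hloop : ∀ v, ¬ G.Adj v v) (h : s.perceived = s.flow) (v : V) :
    0 ≤ received l u P s v :=
  add_nonneg (Finset.sum_nonneg fun e _ => received_in_nonneg hloop s e)
    (Finset.sum_nonneg fun e _ => received_out_nonneg hloop h e)

theorem balance_losslessIteration (hloop : ∀ v, ¬ G.Adj v v) (hs : IsFeasible l u s)
    (h : s.perceived = s.flow) (v : V) :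
    balance (losslessIteration l u P s).flow v =
      balance (selectDesirable l u P v (nodeView s v)).flow v + received l u P s v := by
  have h1 : ∑ e ∈ inEdges G v, (losslessIteration l u P s).flow e =
      ∑ e ∈ inEdges G v, ((selectDesirable l u P v (nodeView s v)).flow e +
      ((selectDesirable l u P e.tail (nodeView s e.tail)).flow e - s.flow e)) :=
    Finset.sum_congr rfl fun e he => by
      rw [losslessIteration_flow hloop hs h, mem_inEdges.1 he]
      ring
  have h2 : ∑ e ∈ outEdges G v, (losslessIteration l u P s).flow e =
      ∑ e ∈ outEdges G v, ((selectDesirable l u P v (nodeView s v)).flow e -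
      (s.flow e - (selectDesirable l u P e.head (nodeView s e.head)).flow e)) :=
    Finset.sum_congr rfl fun e he => by
      rw [losslessIteration_flow hloop hs h, mem_outEdges.1 he]
      ring
  unfold balance received
  rw [h1, h2, Finset.sum_add_distrib, Finset.sum_sub_distrib (f := fun e =>
    (selectDesirable l u P v (nodeView s v)).flow e)]
  ring

theorem balance_losslessIteration_of_nonpos (hloop : ∀ v, ¬ G.Adj v v) (hs : IsFeasible l u s)
    (h : s.perceived = s.flow) {v : V} (hb : balance s.flow v ≤ 0) :
    balance (losslessIteration l u P s).flow v =
      balance s.flow v + received l u P s v := by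
  rw [balance_losslessIteration hloop hs h, selectDesirable_of_nonpos, nodeView_flow h]
  rwa [nodeView_flow h]

theorem balance_losslessIteration_of_pos (hloop : ∀ v, ¬ G.Adj v v)
    (hcirc : IntegerCirculationConditions l u) (hP : IsEdgeOrder P) (hs : IsFeasible l u s)
    (h : s.perceived = s.flow) {v : V} (hb : 0 < balance s.flow v) :
    balance (losslessIteration l u P s).flow v = received l u P s v := by
  rw [balance_losslessIteration hloop hs h,
    balance_selectDesirable_of_pos hloop hcirc hP (hs.next_lt v), zero_add]
  rwa [nodeView_flow h]

/-- A node that trials its edges in a cyclic order infinitely often tries each number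
infinitely often. -/
theorem exists_cyclic_hit {D j : ℕ} (hj : j < D) {nx n : ℕ → ℕ} (h0 : ∀ k, nx k < D)
    (hnx : ∀ k, nx (k + 1) = (nx k + n k) % D) (hn : ∃ᶠ k in atTop, 0 < n k) (K : ℕ) :
    ∃ k ≥ K, ∃ m < n k, (nx k + m) % D = j := by
  -- The pointer from time `K` on, without reduction modulo `D`.
  let c : ℕ → ℕ := fun k => nx K + ∑ i ∈ Finset.range k, n (K + i)
  have hc : ∀ k, c (k + 1) = c k + n (K + k) := fun k => by
    simp [c, Finset.sum_range_succ, add_assoc]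
  have hmod : ∀ k, nx (K + k) = c k % D := fun k => by
    induction k with
    | zero => simp [c, Nat.mod_eq_of_lt (h0 K)]
    | succ k ih => rw [← add_assoc, hnx, ih, hc, Nat.mod_add_mod]
  have hmono : Monotone c := monotone_nat_of_le_succ fun k => by rw [hc]; omega
  have hunb : ∀ N, ∃ k, N < c k := fun N => by
    induction N with
    | zero =>
      obtain ⟨k, hk, hk'⟩ := frequently_atTop.1 hn K
      refine ⟨k - K + 1, ?_⟩
      rw [hc, Nat.add_sub_of_le hk]
      omega
    | succ N ih =>
      obtain ⟨i, hi⟩ := ih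
      obtain ⟨k, hk, hk'⟩ := frequently_atTop.1 hn (K + i)
      refine ⟨k - K + 1, ?_⟩
      have := hmono (show i ≤ k - K by omega)
      rw [hc, Nat.add_sub_of_le (by omega)]
      omega
  -- The trials of the step in which `c` first exceeds `D + j` include the number `D + j`, congruent
  -- to `j`. The summand `D` ensures that the threshold is not already passed at the start, where `c
  -- 0 < D`.
  have ht := hunb (D + j)
  have hfind := Nat.find_spec ht
  cases hk : Nat.find ht with
  | zero =>
    rw [hk] at hfind
    have := h0 K
    simp [c] at hfind
    omega
  | succ k =>
    rw [hk, hc] at hfind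
    have hmin := Nat.find_min ht (m := k) (by omega)
    refine ⟨K + k, by omega, D + j - c k, by omega, ?_⟩
    rw [hmod, Nat.mod_add_mod, Nat.add_sub_of_le (by omega), Nat.add_mod_left,
      Nat.mod_eq_of_lt hj]

theorem sum_balance (f : Edge G → ℤ) (S : Finset V) :
    ∑ v ∈ S, balance f v = ∑ e ∈ edgesInto G S, f e - ∑ e ∈ edgesOutOf G S, f e := by
  have h1 : ∑ v ∈ S, ∑ e ∈ inEdges G v, f e = ∑ e : Edge G, if e.head ∈ S then f e else 0 := by
    simp only [inEdges, Finset.sum_filter]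
    rw [Finset.sum_comm]
    exact Finset.sum_congr rfl fun e _ => by simp
  have h2 : ∑ v ∈ S, ∑ e ∈ outEdges G v, f e = ∑ e : Edge G, if e.tail ∈ S then f e else 0 := by
    simp only [outEdges, Finset.sum_filter]
    rw [Finset.sum_comm]
    exact Finset.sum_congr rfl fun e _ => by simp
  unfold balance edgesInto edgesOutOf
  rw [Finset.sum_sub_distrib, h1, h2, Finset.sum_filter, Finset.sum_filter,
    ← Finset.sum_sub_distrib, ← Finset.sum_sub_distrib]
  refine Finset.sum_congr rfl fun e _ => ?_
  by_cases ha : e.head ∈ S <;> by_cases hb : e.tail ∈ S <;> simp [ha, hb]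

theorem lossless_invariants (hloop : ∀ v, ¬ G.Adj v v) (hs : IsFeasible l u s)
    (h : s.perceived = s.flow) (k : ℕ) :
    IsFeasible l u ((losslessIteration l u P)^[k] s) ∧
      ((losslessIteration l u P)^[k] s).perceived = ((losslessIteration l u P)^[k] s).flow := by
  induction k with
  | zero => exact ⟨hs, h⟩
  | succ k ih =>
    rw [Function.iterate_succ_apply']
    exact ⟨ih.1.iteration hloop _, losslessIteration_perceived _⟩

/-- If the edges of a node that fires infinitely often eventually remain as they are, then they
are eventually saturated in the direction away from the node. -/
theorem eventually_saturated (hloop : ∀ v, ¬ G.Adj v v)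
    (hcirc : IntegerCirculationConditions l u) (hP : IsEdgeOrder P)
    (hs : IsFeasible l u s) (h : s.perceived = s.flow) {v : V}
    (hv : ∃ᶠ k in atTop, 0 < balance ((losslessIteration l u P)^[k] s).flow v) {e : Edge G}
    (he : e.head = v ∨ e.tail = v)
    (hdes : ∀ᶠ k in atTop, (selectDesirable l u P v
      (nodeView ((losslessIteration l u P)^[k] s) v)).flow e =
      ((losslessIteration l u P)^[k] s).flow e)
    (hcon : ∀ᶠ k in atTop, ((losslessIteration l u P)^[k + 1] s).flow e =
      ((losslessIteration l u P)^[k] s).flow e) :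
    (e.tail = v → ∀ᶠ k in atTop, ⌊u e⌋ ≤ ((losslessIteration l u P)^[k] s).flow e) ∧
    (e.head = v → ∀ᶠ k in atTop, ((losslessIteration l u P)^[k] s).flow e ≤ ⌈l e⌉) := by
  set σ : ℕ → NetworkState G := fun k => (losslessIteration l u P)^[k] s with hσ
  have hinv := lossless_invariants (P := P) hloop hs h
  choose n hn using fun k => selectDesirable_eq_iterate l u P v (nodeView (σ k) v)
  obtain ⟨K, hK⟩ := eventually_atTop.1 (hdes.and hcon)
  have hview : ∀ k, (nodeView (σ k) v).flow = (σ k).flow := fun k => nodeView_flow (hinv k).2 v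
  have hlt : ∀ k, (nodeView (σ k) v).next < totalDegree G v := fun k => (hinv k).1.next_lt v
  obtain ⟨k, hk, m, hm, hj⟩ := exists_cyclic_hit (D := totalDegree G v) (j := P v e)
    ((hP v).mapsTo (by simpa [mem_inEdges, mem_outEdges] using he))
    (nx := fun k => (σ k).next v) (n := n) hlt
    (fun k => by
      have h1 := iterate_next (l := l) (u := u) (P := P) (hlt k) (n k)
      rw [← hn k] at h1
      refine Eq.trans ?_ h1
      simp only [hσ, Function.iterate_succ_apply']
      rfl)
    -- A positive balance is driven to zero, which takes at least one trial.
    (hv.mono fun k hk => by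
      by_contra hz
      have hz : n k = 0 := by omega
      have h1 := balance_selectDesirable_of_pos (l := l) (u := u) (P := P) (v := v)
        (s := nodeView (σ k) v) hloop hcirc hP (hlt k) (by rw [hview]; exact hk)
      rw [hn k, hz, Function.iterate_zero, id, hview] at h1
      exact hk.ne' h1) K
  have htried : P v e = ((tryNextEdge l u P v)^[m] (nodeView (σ k) v)).next := by
    rw [iterate_next (hlt k)]
    exact hj.symm
  have hun : ((tryNextEdge l u P v)^[n k] (nodeView (σ k) v)).flow e =
      (nodeView (σ k) v).flow e := by
    rw [← hn k, hview]
    exact (hK k hk).1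
  have hconst : ∀ j ≥ k, (σ j).flow e = (σ k).flow e := fun j hj => by
    induction j, hj using Nat.le_induction with
    | base => rfl
    | succ j hj ih => rw [← ih]; exact (hK j (by omega)).2
  refine ⟨fun he => ?_, fun he => ?_⟩ <;> filter_upwards [eventually_ge_atTop k] with j hj
  · have := floor_le_of_tried hloop he hm htried hun
    rw [hview, ← hconst j hj] at this
    exact this
  · have := le_ceil_of_tried hloop he hm htried hun
    rw [hview, ← hconst j hj] at this
    exact this

/-- Without packet drops, the flows become balanced. -/
theorem exists_lossless_balanced (hloop : ∀ v, ¬ G.Adj v v)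
    (hcirc : IntegerCirculationConditions l u) (hP : IsEdgeOrder P)
    (hs : IsFeasible l u s) (h : s.perceived = s.flow) :
    ∃ k, ∀ v, balance ((losslessIteration l u P)^[k] s).flow v = 0 := by
  classical
  set σ : ℕ → NetworkState G := fun k => (losslessIteration l u P)^[k] s with hσ
  have hinv := lossless_invariants (P := P) hloop hs h
  have hsucc : ∀ k, σ (k + 1) = losslessIteration l u P (σ k) :=
    fun k => Function.iterate_succ_apply' _ _ _
  set S : Finset V := {v | ∃ᶠ k in atTop, 0 < balance (σ k).flow v} with hS
  have hmemS : ∀ v, v ∈ S ↔ ∃ᶠ k in atTop, 0 < balance (σ k).flow v := fun v => by simp [hS]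
  -- Once nonnegative, a balance stays so: a positive one is replaced by what the node receives, and
  -- a zero one is increased by it.
  have hin : ∀ v ∈ S, ∀ᶠ k in atTop, 0 ≤ balance (σ k).flow v := fun v hv => by
    obtain ⟨K, hK⟩ := ((hmemS v).1 hv).exists
    filter_upwards [eventually_ge_atTop K] with k hk
    induction k, hk using Nat.le_induction with
    | base => exact hK.le
    | succ k hk ih =>
      have hR := received_nonneg (l := l) (u := u) (P := P) hloop (hinv k).2 v
      rw [hsucc]
      rcases ih.eq_or_lt with h0 | h0
      · rw [balance_losslessIteration_of_nonpos hloop (hinv k).1 (hinv k).2 h0.ge]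
        exact add_nonneg ih hR
      · rwa [balance_losslessIteration_of_pos hloop hcirc hP (hinv k).1 (hinv k).2 h0]
  have hout : ∀ v ∉ S, ∀ᶠ k in atTop, balance (σ k).flow v ≤ 0 := fun v hv => by
    simpa [hmemS] using hv
  have hrec : ∀ v ∉ S, ∀ᶠ k in atTop, received l u P (σ k) v = 0 := fun v hv => by
    obtain ⟨K, hK⟩ := eventually_atTop.1 (hout v hv)
    have hb : ∀ k ≥ K, balance (σ (k + 1)).flow v =
        balance (σ k).flow v + received l u P (σ k) v := fun k hk => by
      rw [hsucc]
      exact balance_losslessIteration_of_nonpos hloop (hinv k).1 (hinv k).2 (hK k hk)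
    obtain ⟨K', hK', h1⟩ := eventually_const_of_monotone
      (a := fun k => balance (σ k).flow v) (K := K) (B := 0)
      (fun k hk => by
        rw [hb k hk]
        exact le_add_of_nonneg_right (received_nonneg hloop (hinv k).2 v)) hK
    filter_upwards [eventually_ge_atTop K'] with k hk
    have := h1 k hk
    rw [hb k (by omega)] at this
    omega
  have hidle : ∀ v ∉ S, ∀ᶠ k in atTop, (selectDesirable l u P v (nodeView (σ k) v)).flow =
      (σ k).flow := fun v hv => by
    filter_upwards [hout v hv] with k hk
    rw [selectDesirable_of_nonpos, nodeView_flow (hinv k).2]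
    rwa [nodeView_flow (hinv k).2]
  -- What a node receives is a sum of nonnegative terms, so receiving nothing means that no
  -- neighbour changes a shared edge.
  have hsplit : ∀ v k, received l u P (σ k) v = 0 →
      (∀ e ∈ inEdges G v, (selectDesirable l u P e.tail (nodeView (σ k) e.tail)).flow e =
        (σ k).flow e) ∧
      (∀ e ∈ outEdges G v, (selectDesirable l u P e.head (nodeView (σ k) e.head)).flow e =
        (σ k).flow e) := fun v k hk => by
    have h1 : ∀ e ∈ inEdges G v, 0 ≤ (selectDesirable l u P e.tail
      (nodeView (σ k) e.tail)).flow e - (σ k).flow e := fun e _ => received_in_nonneg hloop _ e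
    have h2 : ∀ e ∈ outEdges G v, 0 ≤ (σ k).flow e - (selectDesirable l u P e.head
      (nodeView (σ k) e.head)).flow e := fun e _ => received_out_nonneg hloop (hinv k).2 e
    have h3 := (add_eq_zero_iff_of_nonneg (Finset.sum_nonneg h1) (Finset.sum_nonneg h2)).1 hk
    rw [Finset.sum_eq_zero_iff_of_nonneg h1, Finset.sum_eq_zero_iff_of_nonneg h2] at h3
    exact ⟨fun e he => sub_eq_zero.1 (h3.1 e he), fun e he => (sub_eq_zero.1 (h3.2 e he)).symm⟩
  have hfix : ∀ k (e : Edge G),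
      (selectDesirable l u P e.tail (nodeView (σ k) e.tail)).flow e = (σ k).flow e →
      (selectDesirable l u P e.head (nodeView (σ k) e.head)).flow e = (σ k).flow e →
      (σ (k + 1)).flow e = (σ k).flow e := fun k e h1 h2 => by
    rw [hsucc, losslessIteration_flow hloop (hinv k).1 (hinv k).2, h1, h2]
    ring
  have hsatOut : ∀ e ∈ edgesOutOf G S, ∀ᶠ k in atTop, ⌊u e⌋ ≤ (σ k).flow e := fun e he => by
    simp only [edgesOutOf, Finset.mem_filter, Finset.mem_univ, true_and] at he
    refine (eventually_saturated hloop hcirc hP hs h ((hmemS _).1 he.1) (Or.inr rfl) ?_ ?_).1 rfl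
    · filter_upwards [hrec _ he.2] with k hk
      exact (hsplit _ k hk).1 e (mem_inEdges.2 rfl)
    · filter_upwards [hrec _ he.2, hidle _ he.2] with k hk hk'
      exact hfix k e ((hsplit _ k hk).1 e (mem_inEdges.2 rfl)) (congrFun hk' e)
  have hsatIn : ∀ e ∈ edgesInto G S, ∀ᶠ k in atTop, (σ k).flow e ≤ ⌈l e⌉ := fun e he => by
    simp only [edgesInto, Finset.mem_filter, Finset.mem_univ, true_and] at he
    refine (eventually_saturated hloop hcirc hP hs h ((hmemS _).1 he.1) (Or.inl rfl) ?_ ?_).2 rfl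
    · filter_upwards [hrec _ he.2] with k hk
      exact (hsplit _ k hk).2 e (mem_outEdges.2 rfl)
    · filter_upwards [hrec _ he.2, hidle _ he.2] with k hk hk'
      exact hfix k e (congrFun hk' e) ((hsplit _ k hk).2 e (mem_outEdges.2 rfl))
  have hzero : ∀ᶠ k in atTop, ∀ v ∈ S, balance (σ k).flow v = 0 := by
    filter_upwards [(Finset.eventually_all S).2 hin,
      (Finset.eventually_all _).2 hsatOut, (Finset.eventually_all _).2 hsatIn] with k h1 h2 h3
    refine (Finset.sum_eq_zero_iff_of_nonneg h1).1 (le_antisymm ?_ (Finset.sum_nonneg h1))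
    rw [sum_balance]
    have h4 := Finset.sum_le_sum h2
    have h5 := Finset.sum_le_sum h3
    have h6 := hcirc.cut S
    linarith
  have hempty : ∀ v, v ∉ S := fun v hv => by
    obtain ⟨k, hk, hk'⟩ := (((hmemS v).1 hv).and_eventually hzero).exists
    exact hk.ne' (hk' v hv)
  obtain ⟨k, hk⟩ := (eventually_all.2 fun v => hout v (hempty v)).exists
  refine ⟨k, fun v => ?_⟩
  -- No edge enters or leaves the whole node set.
  have h1 : ∑ v, balance (σ k).flow v = 0 := by
    rw [sum_balance]
    simp [edgesInto, edgesOutOf]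
  exact (Finset.sum_eq_zero_iff_of_nonpos fun v _ => hk v).1 h1 v (Finset.mem_univ v)

end Network

end FlowBalancing

namespace FlowBalancing

/-! ### Uniform lossless time and almost sure convergence -/

section Convergence

open Filter

variable {V : Type*} [Fintype V] [DecidableEq V] {G : Digraph V} [DecidableRel G.Adj]
variable {l u : Edge G → ℝ} {P : V → Edge G → ℕ}

theorem finite_synchronized (l u : Edge G → ℝ) :
    {s : NetworkState G | IsFeasible l u s ∧ s.perceived = s.flow}.Finite := by
  have hfin : ((Set.Icc (fun e => ⌈l e⌉) fun e => ⌊u e⌋) ×ˢ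
      Set.Icc 0 (totalDegree G)).Finite := (Set.finite_Icc _ _).prod (Set.finite_Icc _ _)
  refine (hfin.image fun p : (Edge G → ℤ) × (V → ℕ) => NetworkState.mk p.1 p.1 p.2).subset ?_
  rintro ⟨f, p, nx⟩ ⟨hs, h⟩
  obtain rfl : p = f := h
  exact ⟨(p, nx), ⟨⟨hs.ceil_le, hs.le_floor⟩, fun _ => Nat.zero_le _, fun v => (hs.next_lt v).le⟩,
    rfl⟩

theorem exists_uniform_lossless_balanced (hloop : ∀ v, ¬ G.Adj v v)
    (hcirc : IntegerCirculationConditions l u) (hP : IsEdgeOrder P) :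
    ∃ N, ∀ s : NetworkState G, IsFeasible l u s → s.perceived = s.flow →
      ∀ v, balance ((losslessIteration l u P)^[N] s).flow v = 0 := by
  have h1 : ∀ s ∈ {s : NetworkState G | IsFeasible l u s ∧ s.perceived = s.flow},
      ∃ k, ∀ N ≥ k, ∀ v, balance ((losslessIteration l u P)^[N] s).flow v = 0 := by
    rintro s ⟨hs, h⟩
    obtain ⟨k, hk⟩ := exists_lossless_balanced hloop hcirc hP hs h
    have hinv := lossless_invariants (P := P) hloop hs h k
    refine ⟨k, fun N hN => ?_⟩
    rw [← Nat.sub_add_cancel hN, Function.iterate_add_apply,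
      Function.iterate_fixed (iteration_of_balanced hinv.1 hinv.2 hk _)]
    exact hk
  have h2 := ((finite_synchronized l u).eventually_all
    (l := atTop) (p := fun s N => ∀ v, balance ((losslessIteration l u P)^[N] s).flow v = 0)).2
    fun s hs => by
      obtain ⟨k, hk⟩ := h1 s hs
      exact eventually_atTop.2 ⟨k, hk⟩
  obtain ⟨N, hN⟩ := h2.exists
  exact ⟨N, fun s hs h => hN s ⟨hs, h⟩⟩

theorem isFeasible_run (hn : 2 ≤ Fintype.card V) (hconn : StronglyConnected G)
    (hloop : ∀ v, ¬ G.Adj v v) (hcirc : IntegerCirculationConditions l u)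
    (ok : ℕ → Edge G → Direction → Bool) (k : ℕ) : IsFeasible l u (run l u P ok k) := by
  induction k with
  | zero => exact isFeasible_startState hn hconn hcirc
  | succ k ih => exact ih.iteration hloop _

theorem run_add_of_lossless {ok : ℕ → Edge G → Direction → Bool} {a : ℕ} (N : ℕ)
    (h : ∀ j < N, ∀ e d, ok (a + j) e d = true) :
    run l u P ok (a + N) = (losslessIteration l u P)^[N] (run l u P ok a) := by
  induction N with
  | zero => rfl
  | succ N ih =>
    have h1 : ok (a + N) = fun _ _ => true := by
      ext e d
      exact h N (Nat.lt_succ_self N) e d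
    rw [Function.iterate_succ_apply', ← ih fun j hj => h j (by omega), ← add_assoc, run, h1]

theorem run_eq_of_balanced {ok : ℕ → Edge G → Direction → Bool} {a : ℕ}
    (hs : IsFeasible l u (run l u P ok a))
    (h : (run l u P ok a).perceived = (run l u P ok a).flow)
    (hb : ∀ v, balance (run l u P ok a).flow v = 0) {k : ℕ} (hk : a ≤ k) :
    run l u P ok k = run l u P ok a := by
  induction k, hk using Nat.le_induction with
  | base => rfl
  | succ k hk ih =>
    rw [run, ih]
    exact iteration_of_balanced hs h hb _

instance : Fintype Direction where
  elems := {.toHead, .toTail}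
  complete d := by cases d <;> simp

/-- The transmissions of the `i`-th block of `M` iterations. -/
def blockPackets (G : Digraph V) [DecidableRel G.Adj] (M i : ℕ) :
    Finset (ℕ × Edge G × Direction) :=
  Finset.Ico (i * M) (i * M + M) ×ˢ Finset.univ

omit [DecidableEq V] in
theorem disjoint_blockPackets (M : ℕ) {i j : ℕ} (hij : i ≠ j) :
    Disjoint (blockPackets G M i) (blockPackets G M j) := by
  wlog h : i < j generalizing i j
  · exact (this hij.symm (by omega)).symm
  have h1 : (i + 1) * M ≤ j * M := Nat.mul_le_mul_right _ h
  rw [add_mul, one_mul] at h1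
  rw [Finset.disjoint_left]
  intro a ha hb
  simp only [blockPackets, Finset.mem_product, Finset.mem_Ico, Finset.mem_univ, and_true] at ha hb
  omega

variable {Ω : Type*} [MeasurableSpace Ω] {μ : Measure Ω} [IsProbabilityMeasure μ]
  {q : Edge G → Direction → ℝ} {x : ℕ × Edge G × Direction → Ω → Bool}

omit [Fintype V] [DecidableEq V] [DecidableRel G.Adj] in
theorem IsPacketDropModel.measure_arrives (hx : IsPacketDropModel μ q x)
    (i : ℕ × Edge G × Direction) :
    μ (x i ⁻¹' {true}) = ENNReal.ofReal (1 - q i.2.1 i.2.2) := by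
  have h1 : x i ⁻¹' {true} = (x i ⁻¹' {false})ᶜ := by
    ext ω
    simp
  have h2 := hx.measurable i (measurableSet_singleton false)
  rw [← hx.drop i.1, ← ofReal_measureReal, h1, probReal_compl_eq_one_sub h2]
  rfl

/-- Almost surely there is a block of `M` successive iterations without any packet drop. -/
theorem IsPacketDropModel.ae_exists_lossless_block (hx : IsPacketDropModel μ q x)
    (hq : ∀ e d, q e d < 1) (M : ℕ) :
    ∀ᵐ ω ∂μ, ∃ a, ∀ j < M, ∀ e d, x (a + j, e, d) ω = true := by
  let B : ℕ → Set Ω := fun i => ⋂ p ∈ blockPackets G M i, x p ⁻¹' {true}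
  have hprod : ∀ T : Finset (ℕ × Edge G × Direction),
      μ (⋂ p ∈ T, x p ⁻¹' {true}) = ∏ p ∈ T, μ (x p ⁻¹' {true}) := fun T =>
    hx.indep.measure_inter_preimage_eq_mul T fun _ _ => measurableSet_singleton true
  have hmeas : ∀ i, MeasurableSet (B i) := fun i =>
    Finset.measurableSet_biInter _ fun p _ => hx.measurable p (measurableSet_singleton true)
  have hindep : iIndepSet B μ := by
    classical
    rw [iIndepSet_iff_meas_biInter hmeas]
    intro t
    have h1 : ⋂ i ∈ t, B i = ⋂ p ∈ t.biUnion (blockPackets G M), x p ⁻¹' {true} :=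
      (Finset.set_biInter_biUnion _ _ _).symm
    rw [h1, hprod, Finset.prod_biUnion fun i _ j _ hij => disjoint_blockPackets M hij]
    exact Finset.prod_congr rfl fun i _ => (hprod _).symm
  have hB : ∀ i, μ (B i) =
      (∏ p : Edge G × Direction, ENNReal.ofReal (1 - q p.1 p.2)) ^ M := fun i => by
    simp only [B]
    rw [hprod]
    simp only [hx.measure_arrives]
    rw [blockPackets, Finset.prod_product]
    simp
  -- All blocks have the same positive probability, so the probabilities have a divergent sum and
  -- the second Borel–Cantelli lemma applies.
  have hpos : (∏ p : Edge G × Direction, ENNReal.ofReal (1 - q p.1 p.2)) ^ M ≠ 0 :=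
    pow_ne_zero _ <| Finset.prod_ne_zero_iff.2 fun p _ => by
      simpa using hq p.1 p.2
  have hlim := measure_limsup_eq_one hmeas hindep (by
    simp only [hB]
    exact ENNReal.tsum_const_eq_top_of_ne_zero hpos)
  have hae : ∀ᵐ ω ∂μ, ω ∈ limsup B atTop :=
    (prob_compl_eq_zero_iff (MeasurableSet.measurableSet_limsup hmeas)).2 hlim
  filter_upwards [hae] with ω hω
  obtain ⟨i, hi⟩ := (mem_limsup_iff_frequently_mem.1 hω).exists
  refine ⟨i * M, fun j hj e d => ?_⟩
  exact Set.mem_iInter₂.1 hi (i * M + j, e, d) (by simp [blockPackets, hj])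

end Convergence

end FlowBalancing

open FlowBalancing
theorem proposition7 {V : Type*} [Fintype V] [DecidableEq V] (hn : 2 ≤ Fintype.card V)
    (G : Digraph V) [DecidableRel G.Adj] (hloop : ∀ v, ¬ G.Adj v v)
    (hconn : StronglyConnected G)
    (l u : Edge G → ℝ) (hl : ∀ e, 0 < l e) (hlu : ∀ e, l e ≤ u e)
    (hcirc : IntegerCirculationConditions l u)
    (P : V → Edge G → ℕ) (hP : IsEdgeOrder P)
    {Ω : Type*} [MeasurableSpace Ω] (μ : Measure Ω) [IsProbabilityMeasure μ]
    (q : Edge G → Direction → ℝ) (hq : ∀ e d, q e d < 1)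
    (x : ℕ × Edge G × Direction → Ω → Bool) (hx : IsPacketDropModel μ q x) :
    ∀ᵐ ω ∂μ, ∃ k₀ : ℕ, ∀ k ≥ k₀,
      (∀ e : Edge G,
        (run l u P (fun k e d => x (k, e, d) ω) k).flow e =
            (run l u P (fun k e d => x (k, e, d) ω) k₀).flow e ∧
          0 < (run l u P (fun k e d => x (k, e, d) ω) k).flow e ∧
          l e ≤ ((run l u P (fun k e d => x (k, e, d) ω) k).flow e : ℝ) ∧
          ((run l u P (fun k e d => x (k, e, d) ω) k).flow e : ℝ) ≤ u e) ∧
      ∀ v : V, balance (run l u P (fun k e d => x (k, e, d) ω) k).flow v = 0 := by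
  obtain ⟨N, hN⟩ := exists_uniform_lossless_balanced (l := l) (u := u) (P := P) hloop hcirc hP
  -- One iteration more than `N`: the first makes the perceived flows correct, as the choice of `N`
  -- requires.
  filter_upwards [hx.ae_exists_lossless_block hq (N + 1)] with ω ⟨a, ha⟩
  set ok : ℕ → Edge G → Direction → Bool := fun k e d => x (k, e, d) ω
  have hfeas := isFeasible_run (P := P) hn hconn hloop hcirc ok
  have hsync : (run l u P ok (a + 1)).perceived = (run l u P ok (a + 1)).flow := by
    rw [run_add_of_lossless 1 fun j hj => ha j (by omega)]
    exact losslessIteration_perceived _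
  have hend : run l u P ok (a + 1 + N) =
      (losslessIteration l u P)^[N] (run l u P ok (a + 1)) :=
    run_add_of_lossless N fun j hj e d => by
      rw [add_assoc]
      exact ha (1 + j) (by omega) e d
  have hbal : ∀ v, balance (run l u P ok (a + 1 + N)).flow v = 0 := by
    rw [hend]
    exact hN _ (hfeas _) hsync
  have hsync' : (run l u P ok (a + 1 + N)).perceived = (run l u P ok (a + 1 + N)).flow := by
    rw [hend]
    exact (lossless_invariants hloop (hfeas _) hsync N).2
  refine ⟨a + 1 + N, fun k hk => ?_⟩
  rw [run_eq_of_balanced (hfeas _) hsync' hbal hk]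
  refine ⟨fun e => ?_, hbal⟩
  have h1 := ((hfeas (a + 1 + N)).ceil_le e).trans ((hfeas (a + 1 + N)).perceived_le e)
  have h2 := (hfeas (a + 1 + N)).le_floor e
  exact ⟨rfl, (Int.ceil_pos.2 (hl e)).trans_le h1, Int.ceil_le.1 h1, Int.le_floor.1 h2⟩
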